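/- For a finite abelian group $G$ let $\exp(G)$ be its exponent, and let $\mathfrak{s}(G)$ (the Erdős–Ginzburg–Ziv constant) be the smallest $\ell\in\mathbb{N}$ such that any sequence of $\ell$ elements of $G$ contains a zero-sum subsequence of length $\exp(G)$. For an integer $p\ge 2$ let $$J(p)=\frac1p\min_{0<x<1}\frac{1-x^{p}}{1-x}\,x^{-\frac{p-1}{3}}.$$ Let $k$ be a positive integer that is not a power of $2$ (in particular $k\neq1$), and let $p$ be the largest prime dividing $k$ (so $p$ is odd). Then $$\mathfrak{s}\big((\mathbb{Z}/k\mathbb{Z})^n\big)\le\big(J(p)\,p+o(1)\big)^n,$$ where, for fixed $k$, the $o(1)$ term tends to $0$ as $n\to\infty$. -/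

import Mathlib

open Filter Topology

/-- Every sequence of length `l` of elements of `G` contains a zero-sum subsequence
of length `exp G` (a subsequence is given by its set of positions). -/
def HasEGZProperty (G : Type*) [AddCommGroup G] (l : ℕ) : Prop :=
  ∀ a : Fin l → G, ∃ S : Finset (Fin l),
    S.card = AddMonoid.exponent G ∧ ∑ i ∈ S, a i = 0

/-- The Erdős–Ginzburg–Ziv constant of `G`: the least length `l` such that every sequence
of `l` elements of `G` contains a zero-sum subsequence of length `exp G`. -/
noncomputable def egzConstant (G : Type*) [AddCommGroup G] : ℕ :=
  sInf {l : ℕ | HasEGZProperty G l}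

/-- For a finite abelian group the least length in the definition of `egzConstant` exists. -/
theorem isLeast_egzConstant (G : Type*) [AddCommGroup G] [Finite G] :
    IsLeast {l : ℕ | HasEGZProperty G l} (egzConstant G) := by
  classical
  have hne : {l : ℕ | HasEGZProperty G l}.Nonempty := by
    have := Fintype.ofFinite G
    refine ⟨Fintype.card G * AddMonoid.exponent G, fun a => ?_⟩
    obtain ⟨g, -, hg⟩ := Finset.exists_le_card_fiber_of_mul_le_card_of_maps_to
      (s := (Finset.univ : Finset (Fin (Fintype.card G * AddMonoid.exponent G))))
      (t := (Finset.univ : Finset G)) (f := a) (n := AddMonoid.exponent G)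
      (fun _ _ => Finset.mem_univ _) ⟨0, Finset.mem_univ _⟩ (by simp)
    obtain ⟨S, hS, hcard⟩ := Finset.exists_subset_card_eq hg
    refine ⟨S, hcard, ?_⟩
    have h : ∀ i ∈ S, a i = g := fun i hi => (Finset.mem_filter.mp (hS hi)).2
    rw [Finset.sum_congr rfl h, Finset.sum_const, hcard]
    exact AddMonoid.exponent_nsmul_eq_zero g
  exact ⟨Nat.sInf_mem hne, fun _ h => Nat.sInf_le h⟩

/-- The Ellenberg–Gijswijt constant
`J(p) = (1/p) * min_{0 < x < 1} (1 - x^p) / (1 - x) * x^(-(p-1)/3)`. -/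
noncomputable def ellenbergGijswijtJ (p : ℕ) : ℝ :=
  (1 / (p : ℝ)) * sInf ((fun x : ℝ => (1 - x ^ p) / (1 - x) * x ^ (-(((p : ℝ) - 1) / 3))) ''
    Set.Ioo (0 : ℝ) 1)

/-! The prime factors of `k` are handled one at a time. For an odd prime `q`, take a sequence in
`(ZMod q)^n` without a zero-sum subsequence of length `q`. No value occurs more than `q` times, so
the set `A` of values is large. If some `y ∈ A` were the midpoint of many pairs in `A`, then
`(q-1)/2` of these pairs together with `y` would be `q` terms with sum `q • y = 0`. So each `y` is a
midpoint only boundedly often, and a fixed proportion of `A` is free of three-term progressions. The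
slice rank method (`card_le_three_mul_card_lowDegreeExponents`) and an exponential moment estimate
bound such a set by `3 * (J(q) * q)^n`.

`HasDivisibleSums.mul` combines primes: the thresholds for factors add up to constants depending
only on `k`. With `B = J(p) * p`, every prime `q ≤ p` costs at most a constant times `B ^ n`: odd
`q` by monotonicity in `q`, and `q = 2` because `2 ≤ B`. The resulting bound `(C + 1) * B ^ n` has
`n`-th root tending to `B`. -/

/-! ### Slice rank of diagonal tensors. -/

/-- A finite-dimensional space of functions contains one whose support is at least as large as
the dimension. -/
theorem Submodule.exists_finrank_le_card_support {F X : Type*} [Field F] [Fintype X]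
    [DecidableEq F] (V : Submodule F (X → F)) :
    ∃ h ∈ V, Module.finrank F V ≤ (Finset.univ.filter fun x => h x ≠ 0).card := by
  classical
  have hfin : ∃ h : V, ∀ w : V, (Finset.univ.filter fun x => (w : X → F) x ≠ 0).card ≤
      (Finset.univ.filter fun x => (h : X → F) x ≠ 0).card := by
    let g : V → ℕ := fun w => (Finset.univ.filter fun x => (w : X → F) x ≠ 0).card
    have hb : BddAbove (Set.range g) :=
      ⟨Fintype.card X, by rintro _ ⟨w, rfl⟩; exact Finset.card_le_univ _⟩
    obtain ⟨h, hh⟩ := Nat.sSup_mem (Set.range_nonempty g) hb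
    exact ⟨h, fun w => (le_csSup hb ⟨w, rfl⟩).trans hh.ge⟩
  obtain ⟨h, hmax⟩ := hfin
  refine ⟨h, h.2, ?_⟩
  by_contra! hlt
  set S := Finset.univ.filter fun x => (h : X → F) x ≠ 0
  -- Restriction to a maximal support `S`: a nonzero kernel element vanishes on `S`, so adding it to
  -- `h` enlarges the support.
  let r : V →ₗ[F] (S → F) := (LinearMap.funLeft F F (Subtype.val : S → X)).comp V.subtype
  have hker : LinearMap.ker r ≠ ⊥ := by
    apply LinearMap.ker_ne_bot_of_finrank_lt
    simpa using hlt
  obtain ⟨w, hw, hw0⟩ := Submodule.exists_mem_ne_zero_of_ne_bot hker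
  have hwS : ∀ x ∈ S, (w : X → F) x = 0 := fun x hx => congrFun (LinearMap.mem_ker.mp hw) ⟨x, hx⟩
  obtain ⟨x, hx⟩ : ∃ x, (w : X → F) x ≠ 0 := by
    by_contra! hall
    exact hw0 (Subtype.ext (funext hall))
  have hxS : x ∉ S := fun hxS => hx (hwS x hxS)
  have hsub : insert x S ⊆ Finset.univ.filter fun x => ((h + w : V) : X → F) x ≠ 0 := by
    intro y hy
    rw [Finset.mem_filter]
    refine ⟨Finset.mem_univ _, ?_⟩
    rcases Finset.mem_insert.mp hy with rfl | hyS
    · have : (h : X → F) y = 0 := by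
        by_contra hne
        exact hxS (Finset.mem_filter.mpr ⟨Finset.mem_univ _, hne⟩)
      simpa [this] using hx
    · simpa [hwS y hyS] using (Finset.mem_filter.mp hyS).2
  have h1 := (Finset.card_le_card hsub).trans (hmax (h + w))
  rw [Finset.card_insert_of_notMem hxS] at h1
  change S.card + 1 ≤ S.card at h1
  omega

/-- The slice rank of a diagonal tensor with nonzero diagonal entries is its size. -/
theorem card_le_of_diagonal_slices {F X I J K : Type*} [Field F] [Fintype X] [DecidableEq X]
    [Fintype I] [Fintype J] [Fintype K]
    (t : X → X → X → F) (hdiag : ∀ x, t x x x ≠ 0)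
    (hoff : ∀ x y z, t x y z ≠ 0 → x = y ∧ y = z)
    (f₁ : I → X → F) (g₁ : I → X → X → F) (f₂ : J → X → F) (g₂ : J → X → X → F)
    (f₃ : K → X → F) (g₃ : K → X → X → F)
    (ht : ∀ x y z, t x y z = ∑ i, f₁ i x * g₁ i y z + ∑ j, f₂ j y * g₂ j x z
      + ∑ k, f₃ k z * g₃ k x y) :
    Fintype.card X ≤ Fintype.card I + Fintype.card J + Fintype.card K := by
  classical
  let L : (X → F) →ₗ[F] (I → F) := Matrix.mulVecLin (Matrix.of f₁)
  obtain ⟨h, hV, hcard⟩ := (LinearMap.ker L).exists_finrank_le_card_support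
  have hdim : Fintype.card X ≤ Fintype.card I + Module.finrank F (LinearMap.ker L) := by
    have h1 := L.finrank_range_add_finrank_ker
    have h2 := (LinearMap.range L).finrank_le
    simp only [Module.finrank_fintype_fun_eq_card] at h1 h2
    omega
  have hL : ∀ i, ∑ x, h x * f₁ i x = 0 := by
    intro i
    have := congrFun (LinearMap.mem_ker.mp hV) i
    simp only [L, Matrix.mulVecLin_apply, Matrix.mulVec, dotProduct, Matrix.of_apply,
      Pi.zero_apply] at this
    rw [← this]
    exact Finset.sum_congr rfl fun _ _ => mul_comm _ _
  -- Contracting the first variable with `h`, orthogonal to every `f₁ i`, kills the first family of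
  -- slices and leaves a diagonal matrix of rank at most `#J + #K`.
  have hmat : Matrix.diagonal (fun y => h y * t y y y) =
      (Matrix.of fun y j => f₂ j y) * (Matrix.of fun j z => ∑ x, h x * g₂ j x z) +
      (Matrix.of fun y k => ∑ x, h x * g₃ k x y) * (Matrix.of f₃) := by
    ext y z
    have hsum : ∑ x, h x * t x y z = Matrix.diagonal (fun y => h y * t y y y) y z := by
      rw [Finset.sum_eq_single y]
      · by_cases hyz : y = z
        · subst hyz; simp
        · rw [Matrix.diagonal_apply_ne _ hyz]
          have : t y y z = 0 := by
            by_contra hne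
            exact hyz (hoff _ _ _ hne).2
          simp [this]
      · intro x _ hxy
        have : t x y z = 0 := by
          by_contra hne
          exact hxy (hoff _ _ _ hne).1
        simp [this]
      · simp
    rw [← hsum]
    simp only [ht, Matrix.add_apply, Matrix.mul_apply, Matrix.of_apply, mul_add,
      Finset.sum_add_distrib, Finset.mul_sum, Finset.sum_mul]
    have h1 : ∑ x, ∑ i, h x * (f₁ i x * g₁ i y z) = 0 := by
      rw [Finset.sum_comm]
      refine Finset.sum_eq_zero fun i _ => ?_
      simp only [← mul_assoc]
      rw [← Finset.sum_mul, hL, zero_mul]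
    rw [h1, zero_add]
    congr 1
    · rw [Finset.sum_comm]
      exact Finset.sum_congr rfl fun _ _ => Finset.sum_congr rfl fun _ _ => by ring
    · rw [Finset.sum_comm]
      exact Finset.sum_congr rfl fun _ _ => Finset.sum_congr rfl fun _ _ => by ring
  have hrank : (Finset.univ.filter fun x => h x ≠ 0).card ≤ Fintype.card J + Fintype.card K := by
    have h1 : (Matrix.diagonal (fun y => h y * t y y y)).rank =
        (Finset.univ.filter fun x => h x ≠ 0).card := by
      rw [Matrix.rank_diagonal, Fintype.card_subtype]
      simp [hdiag]
    rw [← h1, hmat]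
    rw [← Matrix.fromCols_mul_fromRows, ← Fintype.card_sum]
    exact (Matrix.rank_mul_le_left _ _).trans (Matrix.rank_le_card_width _)
  omega

theorem Finset.sum_mul_eq_sum_fiberwise {F Φ M : Type*} [Field F] [DecidableEq M] (P : Finset Φ)
    (D : Finset M) (α : Φ → M) (hα : ∀ φ ∈ P, α φ ∈ D) (u : M → F) (c : Φ → F) :
    ∑ φ ∈ P, u (α φ) * c φ = ∑ m : D, u m * ∑ φ ∈ P with α φ = m, c φ := by
  rw [Finset.sum_coe_sort D fun m => u m * ∑ φ ∈ P with α φ = m, c φ,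
    ← Finset.sum_fiberwise_of_maps_to hα]
  refine Finset.sum_congr rfl fun m _ => ?_
  rw [Finset.mul_sum]
  exact Finset.sum_congr rfl fun φ hφ => by rw [(Finset.mem_filter.mp hφ).2]

/-- A diagonal tensor that expands into products `u a x * u b y * u c z`, one of whose indices
always lies in `D`, has size at most `3 * #D`. -/
theorem card_le_three_mul_of_expansion {F X Φ M : Type*} [Field F] [Fintype X] [DecidableEq X]
    [DecidableEq M] (t : X → X → X → F) (hdiag : ∀ x, t x x x ≠ 0)
    (hoff : ∀ x y z, t x y z ≠ 0 → x = y ∧ y = z)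
    (P : Finset Φ) (D : Finset M) (α β γ : Φ → M) (u : M → X → F) (c : Φ → F)
    (hD : ∀ φ ∈ P, α φ ∈ D ∨ β φ ∈ D ∨ γ φ ∈ D)
    (ht : ∀ x y z, t x y z = ∑ φ ∈ P, c φ * (u (α φ) x * u (β φ) y * u (γ φ) z)) :
    Fintype.card X ≤ 3 * D.card := by
  -- Each term is assigned to the first of its three indices that lies in `D`.
  let P₁ := P.filter fun φ => α φ ∈ D
  let Q := P.filter fun φ => α φ ∉ D
  let P₂ := Q.filter fun φ => β φ ∈ D
  let P₃ := Q.filter fun φ => β φ ∉ D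
  have h := card_le_of_diagonal_slices t hdiag hoff (fun m : D => u m)
    (fun m y z => ∑ φ ∈ P₁ with α φ = m, c φ * (u (β φ) y * u (γ φ) z)) (fun m : D => u m)
    (fun m x z => ∑ φ ∈ P₂ with β φ = m, c φ * (u (α φ) x * u (γ φ) z)) (fun m : D => u m)
    (fun m x y => ∑ φ ∈ P₃ with γ φ = m, c φ * (u (α φ) x * u (β φ) y)) ?_
  · simp only [Fintype.card_coe] at h
    omega
  intro x y z
  rw [← Finset.sum_mul_eq_sum_fiberwise P₁ D α (by simp [P₁]) (fun m => u m x),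
    ← Finset.sum_mul_eq_sum_fiberwise P₂ D β (by simp [P₂]) (fun m => u m y),
    ← Finset.sum_mul_eq_sum_fiberwise P₃ D γ ?_ (fun m => u m z), ht,
    ← Finset.sum_filter_add_sum_filter_not P (fun φ => α φ ∈ D),
    ← Finset.sum_filter_add_sum_filter_not (P.filter fun φ => α φ ∉ D) (fun φ => β φ ∈ D),
    ← add_assoc]
  · congr 1
    · congr 1 <;> exact Finset.sum_congr rfl fun _ _ => by ring
    · exact Finset.sum_congr rfl fun _ _ => by ring
  · intro φ hφ
    simp only [P₃, Q, Finset.mem_filter] at hφ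
    have := hD φ hφ.1.1
    tauto

/-! ### The polynomial method for three-term progressions. -/

/-- Polynomial expansion of the indicator of `x + z = 2 * y` over a finite field. -/
theorem exists_expansion_indicator (p : ℕ) (hp : p.Prime) :
    ∃ (T : Finset (Fin 3 →₀ ℕ)) (c : (Fin 3 →₀ ℕ) → ZMod p),
      (∀ d ∈ T, d 0 + d 1 + d 2 ≤ p - 1) ∧ ∀ x y z : ZMod p,
        (if x + z = 2 * y then 1 else 0) = ∑ d ∈ T, c d * (x ^ d 0 * y ^ d 1 * z ^ d 2) := by
  have := Fact.mk hp
  let L : MvPolynomial (Fin 3) (ZMod p) :=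
    MvPolynomial.X 0 - MvPolynomial.C 2 * MvPolynomial.X 1 + MvPolynomial.X 2
  -- By Fermat, `1 - L ^ (p - 1)` is the indicator of `L = 0`.
  let Q : MvPolynomial (Fin 3) (ZMod p) := 1 - L ^ (p - 1)
  have hL : L.totalDegree ≤ 1 := by
    refine (MvPolynomial.totalDegree_add _ _).trans (max_le ?_ (by simp))
    refine (MvPolynomial.totalDegree_sub _ _).trans (max_le (by simp) ?_)
    refine (MvPolynomial.totalDegree_mul _ _).trans ?_
    simp
  have hQ : Q.totalDegree ≤ p - 1 := by
    refine (MvPolynomial.totalDegree_sub _ _).trans (max_le (by simp) ?_)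
    refine (MvPolynomial.totalDegree_pow _ _).trans ?_
    simpa using Nat.mul_le_mul_left (p - 1) hL
  refine ⟨Q.support, Q.coeff, fun d hd => ?_, fun x y z => ?_⟩
  · have := (MvPolynomial.le_totalDegree hd).trans hQ
    rw [Finsupp.sum_fintype _ _ (by simp), Fin.sum_univ_three] at this
    exact this
  · have h := MvPolynomial.eval_eq' ![x, y, z] Q
    simp only [Fin.prod_univ_three, Matrix.cons_val_zero, Matrix.cons_val_one,
      Matrix.cons_val_two, Matrix.head_cons, Matrix.tail_cons] at h
    rw [← h]
    simp only [Q, L, map_sub, map_one, map_pow, map_add, map_mul, MvPolynomial.eval_X,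
      MvPolynomial.eval_C, Matrix.cons_val_zero, Matrix.cons_val_one, Matrix.cons_val]
    split_ifs with hxyz
    · have : x - 2 * y + z = 0 := by linear_combination hxyz
      rw [this, zero_pow (Nat.sub_ne_zero_of_lt hp.one_lt), sub_zero]
    · rw [ZMod.pow_card_sub_one_eq_one, sub_self]
      exact fun h0 => hxyz (by linear_combination h0)

/-- Exponent vectors in `{0, …, p - 1}^n` of total degree at most `n * (p - 1) / 3`. -/
def lowDegreeExponents (p n : ℕ) : Finset (Fin n → ℕ) :=
  (Fintype.piFinset fun _ => Finset.range p).filter fun a => 3 * ∑ i, a i ≤ n * (p - 1)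

/-- The Ellenberg–Gijswijt bound for sets without three-term arithmetic progressions. -/
theorem card_le_three_mul_card_lowDegreeExponents (p n : ℕ) (hp : p.Prime)
    (A : Finset (Fin n → ZMod p))
    (hA : ∀ x ∈ A, ∀ y ∈ A, ∀ z ∈ A, x + z = 2 • y → x = y) :
    A.card ≤ 3 * (lowDegreeExponents p n).card := by
  classical
  have := Fact.mk hp
  obtain ⟨T, c, hT, hTc⟩ := exists_expansion_indicator p hp
  let t : A → A → A → ZMod p := fun x y z =>
    ∏ i, if x.1 i + z.1 i = 2 * y.1 i then 1 else 0
  have h := card_le_three_mul_of_expansion t ?_ ?_ (Fintype.piFinset fun _ : Fin n => T)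
    (lowDegreeExponents p n) (fun φ i => φ i 0) (fun φ i => φ i 1) (fun φ i => φ i 2)
    (fun m x => ∏ i, x.1 i ^ m i) (fun φ => ∏ i, c (φ i)) ?_ ?_
  · simpa using h
  · intro x
    simp [t, two_mul]
  · intro x y z hne
    have hxyz : x.1 + z.1 = 2 • y.1 := by
      funext i
      have := Finset.prod_ne_zero_iff.mp hne i (Finset.mem_univ i)
      simpa using this
    have hxy := hA x x.2 y y.2 z z.2 hxyz
    refine ⟨Subtype.ext hxy, Subtype.ext ?_⟩
    rw [hxy, two_nsmul] at hxyz
    exact (add_left_cancel hxyz).symm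
  · intro φ hφ
    have hd : ∀ i, φ i 0 + φ i 1 + φ i 2 ≤ p - 1 := fun i =>
      hT _ (Fintype.mem_piFinset.mp hφ i)
    have hsum : ∑ i, φ i 0 + ∑ i, φ i 1 + ∑ i, φ i 2 ≤ n * (p - 1) := by
      rw [← Finset.sum_add_distrib, ← Finset.sum_add_distrib]
      simpa using Finset.sum_le_sum fun i (_ : i ∈ Finset.univ) => hd i
    have hpos := hp.pos
    have hmem : ∀ j : Fin 3, (fun i => φ i j) ∈ lowDegreeExponents p n ↔
        3 * ∑ i, φ i j ≤ n * (p - 1) := by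
      intro j
      have : ∀ i, φ i j < p := by
        intro i
        have := hd i
        fin_cases j <;> simp <;> omega
      simp [lowDegreeExponents, this]
    rw [hmem, hmem, hmem]
    -- The three degrees add up to at most `n * (p - 1)`, so one of them is at most a third of that.
    omega
  · intro x y z
    simp only [t, hTc]
    rw [Finset.prod_univ_sum]
    refine Finset.sum_congr rfl fun φ _ => ?_
    simp only [Finset.prod_mul_distrib]

/-! ### Counting low-degree exponents, and bounds on `J(p) * p`. -/

/-- Chernoff bound: as `x < 1`, each low-degree vector contributes at least `x ^ ((p - 1) / 3 * n)`
to the expansion of `(1 + x + ⋯ + x ^ (p - 1)) ^ n`. -/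
theorem card_lowDegreeExponents_le (p n : ℕ) (hp : 0 < p) (x : ℝ) (hx : x ∈ Set.Ioo (0 : ℝ) 1) :
    ((lowDegreeExponents p n).card : ℝ) ≤
      ((1 - x ^ p) / (1 - x) * x ^ (-(((p : ℝ) - 1) / 3))) ^ n := by
  have hgeom : (1 - x ^ p) / (1 - x) = ∑ j ∈ Finset.range p, x ^ j := by
    rw [geom_sum_eq hx.2.ne, ← neg_div_neg_eq, neg_sub, neg_sub]
  have h1 : (∑ j ∈ Finset.range p, x ^ j) ^ n =
      ∑ a ∈ Fintype.piFinset fun _ : Fin n => Finset.range p, ∏ i, x ^ a i := by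
    rw [← Finset.prod_univ_sum]
    simp
  have hpos : 0 < x ^ (((p : ℝ) - 1) / 3 * n) := Real.rpow_pos_of_pos hx.1 _
  have h2 : ((lowDegreeExponents p n).card : ℝ) * x ^ (((p : ℝ) - 1) / 3 * n) ≤
      (∑ j ∈ Finset.range p, x ^ j) ^ n := by
    rw [h1, ← nsmul_eq_mul]
    refine (Finset.card_nsmul_le_sum _ _ _ fun a ha => ?_).trans
      (Finset.sum_le_sum_of_subset_of_nonneg (Finset.filter_subset _ _) fun a _ _ =>
        Finset.prod_nonneg fun _ _ => pow_nonneg hx.1.le _)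
    rw [Finset.prod_pow_eq_pow_sum, ← Real.rpow_natCast]
    refine Real.rpow_le_rpow_of_exponent_ge hx.1 hx.2.le ?_
    have h3 : ((3 * ∑ i, a i : ℕ) : ℝ) ≤ ((n * (p - 1) : ℕ) : ℝ) :=
      Nat.cast_le.mpr (Finset.mem_filter.mp ha).2
    rw [Nat.cast_mul, Nat.cast_mul, Nat.cast_sub hp, Nat.cast_one] at h3
    push_cast at h3 ⊢
    linarith
  rw [hgeom, mul_pow, Real.rpow_neg hx.1.le, inv_pow, ← Real.rpow_natCast (x ^ _),
    ← Real.rpow_mul hx.1.le, ← div_eq_mul_inv, le_div_iff₀ hpos]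
  exact h2

/-- The function minimised in the definition of `ellenbergGijswijtJ`. -/
noncomputable def ellenbergGijswijtFun (p : ℕ) (x : ℝ) : ℝ :=
  (1 - x ^ p) / (1 - x) * x ^ (-(((p : ℝ) - 1) / 3))

theorem ellenbergGijswijtFun_nonneg (p : ℕ) {x : ℝ} (hx : x ∈ Set.Ioo (0 : ℝ) 1) :
    0 ≤ ellenbergGijswijtFun p x :=
  mul_nonneg (div_nonneg (sub_nonneg.mpr (pow_le_one₀ hx.1.le hx.2.le)) (sub_nonneg.mpr hx.2.le))
    (Real.rpow_nonneg hx.1.le _)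

theorem ellenbergGijswijtFun_mono {p q : ℕ} (h : q ≤ p) {x : ℝ} (hx : x ∈ Set.Ioo (0 : ℝ) 1) :
    ellenbergGijswijtFun q x ≤ ellenbergGijswijtFun p x := by
  have hqp : (q : ℝ) ≤ p := Nat.cast_le.mpr h
  unfold ellenbergGijswijtFun
  have h1x : 0 < 1 - x := sub_pos.mpr hx.2
  refine mul_le_mul ?_ ?_ (Real.rpow_nonneg hx.1.le _) ?_
  · have := pow_le_pow_of_le_one hx.1.le hx.2.le h
    gcongr
  · exact Real.rpow_le_rpow_of_exponent_ge hx.1 hx.2.le (by linarith)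
  · exact div_nonneg (sub_nonneg.mpr (pow_le_one₀ hx.1.le hx.2.le)) h1x.le

/-- With `x = u ^ 3` this is `2 * u ^ 2 ≤ 1 + u ^ 3 + u ^ 6`. It lets the bound for `p` absorb the
prime 2. -/
theorem two_le_ellenbergGijswijtFun_three {x : ℝ} (hx : x ∈ Set.Ioo (0 : ℝ) 1) :
    2 ≤ ellenbergGijswijtFun 3 x := by
  obtain ⟨h0, h1⟩ := hx
  have hne : 1 - x ≠ 0 := (sub_pos.mpr h1).ne'
  have hgeom : (1 - x ^ 3) / (1 - x) = 1 + x + x ^ 2 := by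
    field_simp
    ring
  set u := x ^ (1 / 3 : ℝ) with hu
  have hu0 : 0 < u := Real.rpow_pos_of_pos h0 _
  have hxu : x = u ^ 3 := by
    rw [hu, ← Real.rpow_natCast, ← Real.rpow_mul h0.le]
    norm_num
  have hrp : x ^ (-((((3 : ℕ) : ℝ) - 1) / 3)) = (u ^ 2)⁻¹ := by
    rw [hu, ← Real.rpow_natCast, ← Real.rpow_mul h0.le, Real.rpow_neg h0.le]
    norm_num
  unfold ellenbergGijswijtFun
  rw [hgeom, hrp, ← div_eq_mul_inv, le_div_iff₀ (by positivity), hxu]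
  nlinarith [sq_nonneg (u ^ 3 - 1), sq_nonneg (u - 1), sq_nonneg (u ^ 3 - u), pow_pos hu0 3,
    mul_nonneg hu0.le (sq_nonneg (u - 1))]

theorem ellenbergGijswijtJ_mul_self {p : ℕ} (hp : p ≠ 0) :
    ellenbergGijswijtJ p * p = sInf (ellenbergGijswijtFun p '' Set.Ioo (0 : ℝ) 1) := by
  have : (p : ℝ) ≠ 0 := Nat.cast_ne_zero.mpr hp
  unfold ellenbergGijswijtJ ellenbergGijswijtFun
  field_simp

theorem ioo_image_nonempty (f : ℝ → ℝ) : (f '' Set.Ioo (0 : ℝ) 1).Nonempty :=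
  (Set.nonempty_Ioo.mpr one_pos).image _

theorem two_le_ellenbergGijswijtJ_mul_self {p : ℕ} (hp : 3 ≤ p) :
    2 ≤ ellenbergGijswijtJ p * p := by
  rw [ellenbergGijswijtJ_mul_self (by omega)]
  refine le_csInf (ioo_image_nonempty _) ?_
  rintro _ ⟨x, hx, rfl⟩
  exact (two_le_ellenbergGijswijtFun_three hx).trans (ellenbergGijswijtFun_mono hp hx)

/-- The `n`-th root of `c` is a lower bound for the function, hence for its infimum; attainment is
not needed. -/
theorem le_ellenbergGijswijtJ_mul_self_pow {p q n : ℕ} (hqp : q ≤ p) (hp : p ≠ 0) {c : ℝ}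
    (hc : 0 ≤ c) (h : ∀ x ∈ Set.Ioo (0 : ℝ) 1, c ≤ ellenbergGijswijtFun q x ^ n) :
    c ≤ (ellenbergGijswijtJ p * p) ^ n := by
  rcases Nat.eq_zero_or_pos n with rfl | hn
  · simpa using h (1 / 2) ⟨by norm_num, by norm_num⟩
  have hroot : (c ^ (n : ℝ)⁻¹) ^ n = c := Real.rpow_inv_natCast_pow hc hn.ne'
  rw [← hroot, ellenbergGijswijtJ_mul_self hp]
  refine pow_le_pow_left₀ (Real.rpow_nonneg hc _) (le_csInf (ioo_image_nonempty _) ?_) n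
  rintro _ ⟨x, hx, rfl⟩
  refine le_trans ?_ (ellenbergGijswijtFun_mono hqp hx)
  refine le_of_pow_le_pow_left₀ hn.ne' (ellenbergGijswijtFun_nonneg q hx) ?_
  rw [hroot]
  exact h x hx

/-! ### Zero sums over a field of odd prime order. -/

/-- A digraph with all outdegrees at most `d` has a large independent set. -/
theorem Finset.exists_independent_of_outdegree_le {α : Type*} [DecidableEq α] (R : α → α → Prop)
    [DecidableRel R] (d : ℕ) (A : Finset α) (hR : ∀ y ∈ A, (A.filter (R y)).card ≤ d) :
    ∃ I ⊆ A, A.card ≤ (2 * d + 1) * I.card ∧ ∀ x ∈ I, ∀ y ∈ I, x ≠ y → ¬ R y x := by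
  induction A using Finset.strongInduction with
  | H A ih =>
    rcases A.eq_empty_or_nonempty with rfl | hne
    · exact ⟨∅, by simp⟩
    -- Indegrees and outdegrees have the same total, so some indegree is at most `d`.
    have hin : ∃ v ∈ A, (A.filter fun y => R y v).card ≤ d := by
      refine Finset.exists_le_of_sum_le hne ?_
      exact (Finset.sum_card_bipartiteAbove_eq_sum_card_bipartiteBelow R).ge.trans
        (Finset.sum_le_sum hR)
    obtain ⟨v, hv, hvd⟩ := hin
    let N := insert v (A.filter (R v) ∪ A.filter fun y => R y v)
    have hN : N.card ≤ 2 * d + 1 := by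
      refine (Finset.card_insert_le _ _).trans ?_
      have := Finset.card_union_le (A.filter (R v)) (A.filter fun y => R y v)
      have := hR v hv
      omega
    have hss : A \ N ⊂ A :=
      (Finset.ssubset_iff_of_subset Finset.sdiff_subset).mpr
        ⟨v, hv, fun h => (Finset.mem_sdiff.mp h).2 (Finset.mem_insert_self _ _)⟩
    obtain ⟨I, hI, hcard, hind⟩ := ih (A \ N) hss fun y hy =>
      (Finset.card_le_card (Finset.filter_subset_filter _ Finset.sdiff_subset)).trans
        (hR y (Finset.mem_sdiff.mp hy).1)
    have hvI : v ∉ I := fun h => (Finset.mem_sdiff.mp (hI h)).2 (Finset.mem_insert_self _ _)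
    have hnot : ∀ x ∈ I, ¬ R v x ∧ ¬ R x v := by
      intro x hx
      have h := Finset.mem_sdiff.mp (hI hx)
      simp only [N, Finset.mem_insert, Finset.mem_union, Finset.mem_filter, not_or] at h
      exact ⟨fun h' => h.2.2.1 ⟨h.1, h'⟩, fun h' => h.2.2.2 ⟨h.1, h'⟩⟩
    refine ⟨insert v I, Finset.insert_subset hv (hI.trans Finset.sdiff_subset), ?_, ?_⟩
    · rw [Finset.card_insert_of_notMem hvI, mul_add, mul_one]
      have := Finset.card_le_card_sdiff_add_card (s := A) (t := N)
      omega
    · intro x hx y hy hxy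
      rcases Finset.mem_insert.mp hx with hxv | hx' <;> rcases Finset.mem_insert.mp hy with hyv | hy'
      · exact absurd (hxv.trans hyv.symm) hxy
      · exact hxv ▸ (hnot y hy').2
      · exact hyv ▸ (hnot x hx').1
      · exact hind x hx' y hy' hxy

/-- Points that come in pairs symmetric about `y` contain, for each even size they allow, a subset
of that size with the expected sum. -/
theorem Finset.exists_subset_sum_eq_nsmul_of_symmetric {G : Type*} [AddCommGroup G] [DecidableEq G]
    (y : G) (X : Finset G) (hX : ∀ x ∈ X, 2 • y - x ∈ X) (hfix : ∀ x ∈ X, 2 • y - x ≠ x) (m : ℕ)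
    (hm : 2 * m ≤ X.card) : ∃ Y ⊆ X, (∀ x ∈ Y, 2 • y - x ∈ Y) ∧ Y.card = 2 * m ∧
      ∑ x ∈ Y, x = (2 * m) • y := by
  induction m with
  | zero => exact ⟨∅, by simp⟩
  | succ m ih =>
    obtain ⟨Y, hY, hsymm, hcard, hsum⟩ := ih (by omega)
    obtain ⟨x, hx, hxY⟩ := Finset.exists_mem_notMem_of_card_lt_card (s := Y) (t := X) (by omega)
    have hxY' : 2 • y - x ∉ Y := fun h => hxY (by simpa using hsymm _ h)
    have hx' : x ∉ insert (2 • y - x) Y := by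
      simp only [Finset.mem_insert, not_or]
      exact ⟨(hfix x hx).symm, hxY⟩
    refine ⟨insert x (insert (2 • y - x) Y), ?_, ?_, ?_, ?_⟩
    · exact Finset.insert_subset hx (Finset.insert_subset (hX x hx) hY)
    · intro w hw
      simp only [Finset.mem_insert] at hw ⊢
      rcases hw with rfl | rfl | hw
      · exact Or.inr (Or.inl rfl)
      · exact Or.inl (by abel)
      · exact Or.inr (Or.inr (hsymm w hw))
    · rw [Finset.card_insert_of_notMem hx', Finset.card_insert_of_notMem hxY', hcard]
      ring
    · rw [Finset.sum_insert hx', Finset.sum_insert hxY', hsum]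
      rw [show 2 * (m + 1) = 2 * m + 2 by ring, add_nsmul]
      abel


theorem ZMod.nsmul_pi_eq_zero (q : ℕ) {n : ℕ} (g : Fin n → ZMod q) : q • g = 0 := by
  funext i
  simp

/-- Over a field of odd prime order, a long sequence has a zero-sum subsequence of length `q`. -/
theorem exists_zero_sum_of_odd_prime {q n : ℕ} (hq : q.Prime) (hq2 : q ≠ 2) {ι : Type*}
    (s : Finset ι) (v : ι → Fin n → ZMod q)
    (hs : q * ((2 * q + 1) * (3 * (lowDegreeExponents q n).card)) < s.card) :
    ∃ S ⊆ s, S.card = q ∧ ∑ i ∈ S, v i = 0 := by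
  classical
  have := Fact.mk hq
  by_contra! hno
  obtain ⟨m, hm⟩ := hq.odd_of_ne_two hq2
  have htwo : (2 : ZMod q) ≠ 0 := by
    intro h
    have h2 : ((2 : ℕ) : ZMod q) = 0 := by exact_mod_cast h
    rw [ZMod.natCast_eq_zero_iff, Nat.prime_dvd_prime_iff_eq hq Nat.prime_two] at h2
    exact hq2 h2
  have hinj : ∀ x y : Fin n → ZMod q, 2 • x = 2 • y → x = y := by
    intro x y h
    funext i
    have := congrFun h i
    simp only [Pi.smul_apply, nsmul_eq_mul, Nat.cast_ofNat] at this
    exact mul_left_cancel₀ htwo this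
  have hfiber : ∀ g ∈ s.image v, (s.filter fun i => v i = g).card ≤ q := by
    intro g _
    by_contra! hlt
    obtain ⟨S, hS, hcard⟩ := Finset.exists_subset_card_eq hlt.le
    refine hno S (hS.trans (Finset.filter_subset _ _)) hcard ?_
    rw [Finset.sum_congr rfl fun i hi => (Finset.mem_filter.mp (hS hi)).2, Finset.sum_const, hcard,
      ZMod.nsmul_pi_eq_zero]
  set A := s.image v with hA
  have hnoA : ∀ Y ⊆ A, Y.card = q → ∑ x ∈ Y, x ≠ 0 := by
    intro Y hY hcard hsum
    have hpre : ∀ x : Y, ∃ i ∈ s, v i = x := fun x => Finset.mem_image.mp (hY x.2)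
    choose g hgs hgv using hpre
    have hg : Function.Injective g := fun x y hxy =>
      Subtype.ext (by rw [← hgv x, ← hgv y, hxy])
    refine hno (Finset.univ.map ⟨g, hg⟩) ?_ (by simpa using hcard) ?_
    · intro i hi
      obtain ⟨x, -, rfl⟩ := Finset.mem_map.mp hi
      exact hgs x
    · rw [Finset.sum_map, ← hsum, ← Finset.sum_coe_sort Y]
      exact Finset.sum_congr rfl fun x _ => hgv x
  let R : (Fin n → ZMod q) → (Fin n → ZMod q) → Prop := fun y x => x ≠ y ∧ 2 • y - x ∈ A
  have hR : ∀ y ∈ A, (A.filter (R y)).card ≤ q := by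
    intro y hy
    by_contra! hlt
    -- Here `q = 2 * m + 1`: `m` pairs symmetric about `y`, plus `y` itself, give `q` elements with
    -- sum `q • y = 0`.
    have hsub := Finset.exists_subset_sum_eq_nsmul_of_symmetric y
      (A.filter (R y)) ?_ ?_ m (by omega)
    · obtain ⟨Y, hY, -, hcard, hsum⟩ := hsub
      have hyY : y ∉ Y := fun h => (Finset.mem_filter.mp (hY h)).2.1 rfl
      refine hnoA (insert y Y) (Finset.insert_subset hy (hY.trans (Finset.filter_subset _ _)))
        ?_ ?_
      · rw [Finset.card_insert_of_notMem hyY, hcard, hm]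
      · rw [Finset.sum_insert hyY, hsum, ← succ_nsmul', ← hm, ZMod.nsmul_pi_eq_zero]
    · intro x hx
      obtain ⟨hxA, hxy, hx'⟩ := Finset.mem_filter.mp hx
      refine Finset.mem_filter.mpr ⟨hx', fun h => hxy ?_, by simpa using hxA⟩
      rw [two_nsmul, add_sub_assoc, add_eq_left, sub_eq_zero] at h
      exact h.symm
    · intro x hx h
      refine (Finset.mem_filter.mp hx).2.1 (hinj _ _ ?_)
      rw [two_nsmul x]
      exact (sub_eq_iff_eq_add.mp h).symm
  obtain ⟨I, hIA, hcard, hind⟩ := A.exists_independent_of_outdegree_le R q hR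
  have hI := card_le_three_mul_card_lowDegreeExponents q n hq I ?_
  · have h1 := Finset.card_le_mul_card_image s q hfiber
    have h2 := Nat.mul_le_mul_left q (hcard.trans (Nat.mul_le_mul_left (2 * q + 1) hI))
    exact absurd (hs.trans_le (h1.trans h2)) (lt_irrefl _)
  · intro x hx y hy z hz hxyz
    by_contra hne
    refine hind x hx y hy hne ⟨hne, ?_⟩
    rw [← hxyz, add_sub_cancel_left]
    exact hIA hz

/-! ### Multiplicativity and composite moduli. -/

/-- Every family of at least `N` integer vectors contains `k` members whose sum is divisible
by `k`. -/
def HasDivisibleSums (k n : ℕ) (N : ℝ) : Prop :=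
  ∀ (ι : Type) (s : Finset ι) (a : ι → Fin n → ℤ), N ≤ s.card →
    ∃ S ⊆ s, S.card = k ∧ ∀ j, (k : ℤ) ∣ ∑ i ∈ S, a i j

theorem HasDivisibleSums.of_zmod {k n : ℕ} {N : ℝ}
    (h : ∀ (ι : Type) (s : Finset ι) (v : ι → Fin n → ZMod k), N ≤ s.card →
      ∃ S ⊆ s, S.card = k ∧ ∑ i ∈ S, v i = 0) : HasDivisibleSums k n N := by
  intro ι s a hs
  obtain ⟨S, hS, hcard, hsum⟩ := h ι s (fun i j => (a i j : ZMod k)) hs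
  refine ⟨S, hS, hcard, fun j => ?_⟩
  rw [← ZMod.intCast_zmod_eq_zero_iff_dvd]
  have := congrFun hsum j
  simpa [Finset.sum_apply] using this

theorem hasDivisibleSums_two (n : ℕ) : HasDivisibleSums 2 n (2 * 2 ^ n) := by
  refine .of_zmod fun ι s v hs => ?_
  classical
  have hs' : 2 * 2 ^ n ≤ s.card := by exact_mod_cast hs
  have hpos : 0 < 2 ^ n := by positivity
  obtain ⟨x, hx, y, hy, hxy, hv⟩ := Finset.exists_ne_map_eq_of_card_lt_of_maps_to
    (s := s) (t := (Finset.univ : Finset (Fin n → ZMod 2))) (f := v)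
    (by simp; omega) (fun _ _ => Finset.mem_univ _)
  refine ⟨{x, y}, by simp [Finset.insert_subset_iff, hx, hy], Finset.card_pair hxy, ?_⟩
  rw [Finset.sum_pair hxy, hv, ← two_nsmul, ZMod.nsmul_pi_eq_zero]

theorem HasDivisibleSums.mono {k n : ℕ} {N M : ℝ} (h : HasDivisibleSums k n N) (hNM : N ≤ M) :
    HasDivisibleSums k n M :=
  fun ι s a hs => h ι s a (hNM.trans hs)

theorem HasDivisibleSums.exists_disjoint_family {q n : ℕ} {N : ℝ} (hq : 0 < q)
    (h : HasDivisibleSums q n N) {ι : Type} [DecidableEq ι] (s : Finset ι) (a : ι → Fin n → ℤ)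
    (r : ℕ) (hs : N + q * r ≤ s.card) :
    ∃ 𝒮 : Finset (Finset ι), 𝒮.card = r ∧ (∀ S ∈ 𝒮, S ⊆ s ∧ S.card = q ∧
      ∀ j, (q : ℤ) ∣ ∑ i ∈ S, a i j) ∧ (𝒮 : Set (Finset ι)).PairwiseDisjoint id := by
  induction r with
  | zero => exact ⟨∅, by simp⟩
  | succ r ih =>
    push_cast at hs
    have hq' : (0 : ℝ) < q := Nat.cast_pos.mpr hq
    obtain ⟨𝒮, hcard, h𝒮, hdisj⟩ := ih (by nlinarith)
    have hU : (𝒮.biUnion id).card ≤ r * q := by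
      rw [← hcard]
      exact Finset.card_biUnion_le_card_mul _ _ _ fun S hS => (h𝒮 S hS).2.1.le
    have hrest : N ≤ (s \ 𝒮.biUnion id).card := by
      have h1 : (s.card : ℝ) ≤ (s \ 𝒮.biUnion id).card + (r * q : ℕ) := by
        have := Finset.card_le_card_sdiff_add_card (s := s) (t := 𝒮.biUnion id)
        exact_mod_cast this.trans (Nat.add_le_add_left hU _)
      push_cast at h1
      nlinarith
    obtain ⟨S, hS, hSq, hSsum⟩ := h ι _ a hrest
    have hSdisj : ∀ S' ∈ 𝒮, Disjoint S S' := by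
      intro S' hS'
      refine Finset.disjoint_left.mpr fun i hi hi' => (Finset.mem_sdiff.mp (hS hi)).2 ?_
      exact Finset.mem_biUnion.mpr ⟨S', hS', hi'⟩
    have hSnot : S ∉ 𝒮 := by
      intro hmem
      have := disjoint_self.mp (hSdisj S hmem)
      rw [Finset.bot_eq_empty] at this
      rw [this, Finset.card_empty] at hSq
      omega
    refine ⟨insert S 𝒮, by rw [Finset.card_insert_of_notMem hSnot, hcard], ?_, ?_⟩
    · intro S' hS'
      rcases Finset.mem_insert.mp hS' with rfl | hS'
      · exact ⟨hS.trans Finset.sdiff_subset, hSq, hSsum⟩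
      · exact h𝒮 S' hS'
    · rw [Finset.coe_insert]
      exact hdisj.insert fun S' hS' _ => hSdisj S' hS'

/-- Disjoint blocks of size `q` with sums divisible by `q` are extracted greedily; the property for
`m` is then applied to the block sums divided by `q`. This division is why the vectors are integral.
The `+ 1` pays for rounding `M` up to a number of blocks. -/
theorem HasDivisibleSums.mul {q m n : ℕ} {N M : ℝ} (hq : 0 < q) (hM : 0 ≤ M)
    (hN : HasDivisibleSums q n N) (h : HasDivisibleSums m n M) :
    HasDivisibleSums (q * m) n (N + q * (M + 1)) := by
  classical
  intro ι s a hs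
  have hq' : (0 : ℝ) < q := Nat.cast_pos.mpr hq
  obtain ⟨𝒮, hcard, h𝒮, hdisj⟩ := hN.exists_disjoint_family hq s a ⌈M⌉₊ (by
    have := mul_le_mul_of_nonneg_left (Nat.ceil_lt_add_one hM).le hq'.le
    linarith)
  obtain ⟨𝒯, h𝒯, h𝒯card, h𝒯sum⟩ := h (Finset ι) 𝒮 (fun S j => (∑ i ∈ S, a i j) / q)
    (by rw [hcard]; exact Nat.le_ceil M)
  have hdisj' : (𝒯 : Set (Finset ι)).PairwiseDisjoint id := hdisj.subset (by exact_mod_cast h𝒯)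
  refine ⟨𝒯.biUnion id, ?_, ?_, fun j => ?_⟩
  · exact Finset.biUnion_subset.mpr fun S hS => (h𝒮 S (h𝒯 hS)).1
  · have hq𝒯 : ∀ S ∈ 𝒯, (id S).card = q := fun S hS => (h𝒮 S (h𝒯 hS)).2.1
    rw [Finset.card_biUnion hdisj', Finset.sum_congr rfl hq𝒯, Finset.sum_const, h𝒯card,
      smul_eq_mul, mul_comm]
  · rw [Finset.sum_biUnion hdisj']
    have : ∑ S ∈ 𝒯, ∑ i ∈ id S, a i j = q * ∑ S ∈ 𝒯, (∑ i ∈ S, a i j) / q := by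
      rw [Finset.mul_sum]
      exact Finset.sum_congr rfl fun S hS => (Int.mul_ediv_cancel' ((h𝒮 S (h𝒯 hS)).2.2 j)).symm
    rw [this, Nat.cast_mul]
    exact mul_dvd_mul_left _ (h𝒯sum j)

theorem exists_hasDivisibleSums_of_prime {p q : ℕ} (hp : 3 ≤ p) (hq : q.Prime) (hqp : q ≤ p) :
    ∃ C : ℝ, 0 ≤ C ∧ ∀ n, HasDivisibleSums q n (C * (ellenbergGijswijtJ p * p) ^ n) := by
  have hB := two_le_ellenbergGijswijtJ_mul_self hp
  rcases eq_or_ne q 2 with rfl | hq2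
  · refine ⟨2, by norm_num, fun n => (hasDivisibleSums_two n).mono ?_⟩
    have := pow_le_pow_left₀ zero_le_two hB n
    linarith
  · refine ⟨q * ((2 * q + 1) * 3) + 1, by positivity, fun n => .of_zmod fun ι s v hs => ?_⟩
    refine exists_zero_sum_of_odd_prime hq hq2 s v ?_
    have hD : ((lowDegreeExponents q n).card : ℝ) ≤ (ellenbergGijswijtJ p * p) ^ n :=
      le_ellenbergGijswijtJ_mul_self_pow hqp (by omega) (Nat.cast_nonneg _) fun x hx =>
        card_lowDegreeExponents_le q n hq.pos x hx
    have hpos : 0 < (ellenbergGijswijtJ p * p) ^ n := pow_pos (by linarith) n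
    have h1 := mul_le_mul_of_nonneg_left hD
      (by positivity : (0 : ℝ) ≤ (q : ℝ) * ((2 * q + 1) * 3))
    rw [← Nat.cast_lt (α := ℝ)]
    push_cast
    linarith

theorem exists_hasDivisibleSums {p : ℕ} (hp : 3 ≤ p) (k : ℕ) (hk : k ≠ 0)
    (hkp : ∀ q, q.Prime → q ∣ k → q ≤ p) :
    ∃ C : ℝ, 0 ≤ C ∧ ∀ n, HasDivisibleSums k n (C * (ellenbergGijswijtJ p * p) ^ n) := by
  have hB := two_le_ellenbergGijswijtJ_mul_self hp
  have hone : ∀ n, 1 ≤ (ellenbergGijswijtJ p * p) ^ n := fun n => one_le_pow₀ (by linarith)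
  induction k using induction_on_primes with
  | zero => exact absurd rfl hk
  | one =>
    refine ⟨1, zero_le_one, fun n ι s a hs => ?_⟩
    have hs' : (1 : ℝ) ≤ s.card := by linarith [hone n]
    obtain ⟨S, hS, hcard⟩ := Finset.exists_subset_card_eq (Nat.one_le_cast.mp hs')
    exact ⟨S, hS, hcard, by simp⟩
  | prime_mul q m hq ih =>
    obtain ⟨C, hC, h⟩ := ih (right_ne_zero_of_mul hk) fun r hr hrm =>
      hkp r hr (hrm.mul_left q)
    obtain ⟨C', hC', h'⟩ := exists_hasDivisibleSums_of_prime hp hq (hkp q hq (dvd_mul_right q m))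
    refine ⟨C' + q * (C + 1), by positivity, fun n => ?_⟩
    have hn := hone n
    refine ((h' n).mul hq.pos (by positivity) (h n)).mono ?_
    have : (q : ℝ) * 1 ≤ q * (ellenbergGijswijtJ p * p) ^ n :=
      mul_le_mul_of_nonneg_left hn (Nat.cast_nonneg q)
    linarith

/-! ### Return to the Erdős–Ginzburg–Ziv constant. -/

theorem exponent_fin_fun_zmod {n : ℕ} (hn : n ≠ 0) (k : ℕ) :
    AddMonoid.exponent (Fin n → ZMod k) = k := by
  have := Fin.pos_iff_nonempty.mp (Nat.pos_of_ne_zero hn)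
  refine Nat.dvd_antisymm (AddMonoid.exponent_dvd_of_forall_nsmul_eq_zero
    (ZMod.nsmul_pi_eq_zero k)) ?_
  have h := congrFun (AddMonoid.exponent_nsmul_eq_zero (fun _ : Fin n => (1 : ZMod k)))
    ⟨0, Nat.pos_of_ne_zero hn⟩
  rw [← ZMod.natCast_eq_zero_iff]
  simpa using h

theorem HasDivisibleSums.egzConstant_le {k n : ℕ} {N : ℝ} (hn : n ≠ 0) (hN : 0 ≤ N)
    (h : HasDivisibleSums k n N) : (egzConstant (Fin n → ZMod k) : ℝ) ≤ N + 1 := by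
  have hprop : HasEGZProperty (Fin n → ZMod k) ⌈N⌉₊ := by
    intro a
    obtain ⟨S, -, hcard, hsum⟩ := h (Fin ⌈N⌉₊) Finset.univ (fun i j => (a i j).cast)
      (by simpa using Nat.le_ceil N)
    refine ⟨S, by rw [hcard, exponent_fin_fun_zmod hn], funext fun j => ?_⟩
    have := (ZMod.intCast_zmod_eq_zero_iff_dvd _ _).mpr (hsum j)
    simpa [Finset.sum_apply] using this
  exact (Nat.cast_le.mpr (Nat.sInf_le hprop)).trans (Nat.ceil_lt_add_one hN).le

theorem egzConstant_le_one_of_subsingleton (G : Type*) [AddCommGroup G] [Subsingleton G] :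
    egzConstant G ≤ 1 :=
  Nat.sInf_le fun a => ⟨Finset.univ, by simp [AddMonoid.exp_eq_one_of_subsingleton],
    Subsingleton.elim _ _⟩

theorem corollary2 (k p : ℕ) (hp : IsGreatest {q : ℕ | q.Prime ∧ q ∣ k} p) (hp2 : p ≠ 2) :
    ∃ ε : ℕ → ℝ, Tendsto ε atTop (𝓝 0) ∧
      ∀ n : ℕ, (egzConstant (Fin n → ZMod k) : ℝ) ≤
        (ellenbergGijswijtJ p * (p : ℝ) + ε n) ^ n := by
  obtain ⟨⟨hpp, -⟩, hmax⟩ := hp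
  have hp3 : 3 ≤ p := by
    have := hpp.two_le
    omega
  have hk : k ≠ 0 := by
    rintro rfl
    obtain ⟨r, hr, hrp⟩ := Nat.exists_infinite_primes (p + 1)
    have := hmax ⟨hrp, dvd_zero r⟩
    omega
  obtain ⟨C, hC, h⟩ := exists_hasDivisibleSums hp3 k hk fun q hq hqk => hmax ⟨hq, hqk⟩
  set B := ellenbergGijswijtJ p * (p : ℝ)
  have hB : 2 ≤ B := two_le_ellenbergGijswijtJ_mul_self hp3
  have hC1 : 0 < C + 1 := by linarith
  -- Chosen so that `(B + ε n) ^ n = (C + 1) * B ^ n` for `n ≠ 0`; the extra `B ^ n ≥ 1` absorbs the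
  -- rounding in `egzConstant_le`. For `n = 0` the group is trivial, and both sides are compared
  -- with 1.
  refine ⟨fun n => ((C + 1) ^ (n : ℝ)⁻¹ - 1) * B, ?_, fun n => ?_⟩
  · have h1 : Tendsto (fun n : ℕ => (C + 1) ^ (n : ℝ)⁻¹) atTop (𝓝 ((C + 1) ^ (0 : ℝ))) :=
      (Real.continuousAt_const_rpow hC1.ne').tendsto.comp tendsto_inv_atTop_nhds_zero_nat
    rw [Real.rpow_zero] at h1
    simpa using (h1.sub_const 1).mul_const B
  · rcases eq_or_ne n 0 with rfl | hn
    · simpa using egzConstant_le_one_of_subsingleton (Fin 0 → ZMod k)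
    · have heq : B + ((C + 1) ^ (n : ℝ)⁻¹ - 1) * B = (C + 1) ^ (n : ℝ)⁻¹ * B := by ring
      rw [heq, mul_pow, Real.rpow_inv_natCast_pow hC1.le hn]
      have hone : 1 ≤ B ^ n := one_le_pow₀ (by linarith)
      have := (h n).egzConstant_le hn (by positivity)
      linarith
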